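/- Let $R$ and $S$ be associative rings with unit, let $n\ge 1$ and $k\ge 0$ be integers, and let modules be unital left modules unless said otherwise (right $R$-modules are $R^{op}$-modules). Definitions. A module $L$ over a ring $A$ is finitely $n$-presented if there is an exact sequence $F_n\to F_{n-1}\to\cdots\to F_0\to L\to 0$ with every $F_i$ finitely generated free; $A$ is $n$-coherent if every finitely $n$-presented $A$-module is finitely $(n+1)$-presented. An $S$-module $X$ is $fp_n$-injective if for every monomorphism $K\to L$ between finitely $n$-presented $S$-modules the map $\operatorname{Hom}_S(L,X)\to\operatorname{Hom}_S(K,X)$ is surjective. An $(S,R)$-bimodule $C={}_SC_R$ is semidualizing if: ${}_SC$ and $C_R$ both admit resolutions $\cdots\to P_1\to P_0\to C\to 0$ by finitely generated projective modules (over $S$ and over $R^{op}$, respectively); the homothety maps $S\to\operatorname{Hom}_{R^{op}}(C,C)$ and $R\to\operatorname{Hom}_S(C,C)$ are isomorphisms; and $\operatorname{Ext}^i_S(C,C)=0=\operatorname{Ext}^i_{R^{op}}(C,C)$ for all $i\ge1$. It is faithfully semidualizing if moreover, for all $S$-modules $N$ and all right $R$-modules $M$, $\operatorname{Hom}_S(C,N)=0$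 implies $N=0$, and $\operatorname{Hom}_{R^{op}}(C,M)=0$ implies $M=0$. The Auslander class $\mathcal A_C(R)$ consists of the $R$-modules $M$ such that $\operatorname{Tor}_i^R(C,M)=0$ and $\operatorname{Ext}_S^i(C,C\otimes_RM)=0$ for all $i\ge1$, and the evaluation map $M\to\operatorname{Hom}_S(C,C\otimes_RM)$, $m\mapsto(c\mapsto c\otimes m)$, is an isomorphism. An $R$-module is $C$-$fp_n$-injective if it is isomorphic to $\operatorname{Hom}_S(C,X)$ for some $fp_n$-injective $S$-module $X$. The $C$-$fp_n$-injective dimension $Cfp_n.\mathrm{id}_R(M)$ is the least integer $j\ge0$ for which there is an exact sequence $0\to M\to I_0\to\cdots\to I_j\to0$ of $R$-modules with all $I_i$ $C$-$fp_n$-injective, and $\infty$ if there is none. Theorem. Let $S$ be $n$-coherent, let $C={}_SC_R$ be a faithfully semidualizing bimodule, and let $M\in\mathcal A_C(R)$. Then the following are equivalent: (i) $Cfp_n.\mathrm{id}_R(M)\le k$; (ii) for every exact sequence of $R$-modules $0\to M\to M_0\to M_1\to\cdots\to M_{k-1}\to M_k\to0$ with $M_0,\dots,M_{k-1}$ all $C$-$fp_n$-injective,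 the module $M_k$ is $C$-$fp_n$-injective; (iii) there exists an exact sequence of $R$-modules $0\to M\to M_0\to M_1\to\cdots\to M_{k-1}\to M_k\to0$ with $M_0,\dots,M_k$ all $C$-$fp_n$-injective. -/

import Mathlib

open CategoryTheory
open scoped TensorProduct MulOpposite

universe u

namespace Semidual

section Presented

variable (A : Type u) [Ring A] (M : Type u) [AddCommGroup M] [Module A M]

/-- `M` is finitely `n`-presented: there is an exact sequence
`F n → ⋯ → F 1 → F 0 → M → 0` with `F i = A ^ (r i)` finitely generated free.
(The data `r i`, `d i` beyond the range `0, …, n` is unconstrained and irrelevant.) -/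
def IsFinitelyPresented (n : ℕ) : Prop :=
  ∃ (r : ℕ → ℕ) (d : ∀ i, (Fin (r (i + 1)) → A) →ₗ[A] (Fin (r i) → A))
    (p : (Fin (r 0) → A) →ₗ[A] M),
    Function.Surjective p ∧
    (0 < n → Function.Exact (d 0) p) ∧
    ∀ i, i + 1 < n → Function.Exact (d (i + 1)) (d i)

/-- The ring `A` is (left) `n`-coherent: every finitely `n`-presented left `A`-module is
finitely `(n + 1)`-presented. -/
def IsNCoherent (n : ℕ) : Prop :=
  ∀ (L : Type u) [AddCommGroup L] [Module A L],
    IsFinitelyPresented A L n → IsFinitelyPresented A L (n + 1)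

/-- `M` is `fp_n`-injective: every homomorphism `K → M` extends along every monomorphism `K → L`
between finitely `n`-presented modules. -/
def IsFpInjective (n : ℕ) : Prop :=
  ∀ (K L : Type u) [AddCommGroup K] [Module A K] [AddCommGroup L] [Module A L],
    IsFinitelyPresented A K n → IsFinitelyPresented A L n →
    ∀ j : K →ₗ[A] L, Function.Injective j →
      Function.Surjective (fun g : L →ₗ[A] M => g.comp j)

/-- `M` admits a degreewise finite projective resolution: there is an exact sequence
`⋯ → P 1 → P 0 → M → 0` with every `P i` finitely generated projective. -/
def HasDegreewiseFiniteProjectiveResolution : Prop :=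
  ∃ (P : ℕ → ModuleCat.{u} A) (d : ∀ i, P (i + 1) →ₗ[A] P i) (p : P 0 →ₗ[A] M),
    (∀ i, Module.Finite A (P i) ∧ Module.Projective A (P i)) ∧
    Function.Surjective p ∧
    Function.Exact (d 0) p ∧
    ∀ i, Function.Exact (d (i + 1)) (d i)

/-- `Ext_A^i (M, N) = 0` for all `i ≥ 1`. -/
def ExtVanishes (N : Type u) [AddCommGroup N] [Module A N] : Prop :=
  ∀ i : ℕ, 1 ≤ i →
    Subsingleton (Abelian.Ext.{u} (ModuleCat.of A M) (ModuleCat.of A N) i)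

/-- An exact sequence `0 → M → X 0 → X 1 → ⋯ → X k → 0` of `A`-modules, continued by zero
modules to the right of `X k`. -/
structure FiniteCoresolution (k : ℕ) where
  /-- the terms -/
  X : ℕ → ModuleCat.{u} A
  /-- the coaugmentation -/
  ε : M →ₗ[A] X 0
  /-- the maps between the terms -/
  d : ∀ i, X i →ₗ[A] X (i + 1)
  injective_ε : Function.Injective ε
  exact_zero : Function.Exact ε (d 0)
  exact_succ : ∀ i, Function.Exact (d i) (d (i + 1))
  subsingleton_of_lt : ∀ i, k < i → Subsingleton (X i)

end Presented

/- Throughout, an `(S, R)`-bimodule `C` is a left `S`-module which is also a right `R`-module,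
that is, a module over `Rᵐᵒᵖ` (with `c r` written `MulOpposite.op r • c`), such that the two
actions commute. -/

section Bimodule

variable (R S C : Type u) [Ring R] [Ring S] [AddCommGroup C] [Module S C] [Module Rᵐᵒᵖ C]
  [SMulCommClass S Rᵐᵒᵖ C]

section Tensor

variable (M : Type u) [AddCommGroup M] [Module R M]

/-- The additive subgroup of `C ⊗_ℤ M` generated by the elements `c r ⊗ m - c ⊗ r m`; it is
stable under the action of `S` on `C`. -/
def balancedRelations : Submodule S (C ⊗[ℤ] M) where
  toAddSubmonoid := (AddSubgroup.closure {x : C ⊗[ℤ] M | ∃ (c : C) (r : R) (m : M),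
    x = (MulOpposite.op r • c) ⊗ₜ[ℤ] m - c ⊗ₜ[ℤ] (r • m)}).toAddSubmonoid
  smul_mem' s x hx := by
    change x ∈ AddSubgroup.closure _ at hx
    change s • x ∈ AddSubgroup.closure _
    induction hx using AddSubgroup.closure_induction with
    | mem x hx =>
      obtain ⟨c, r, m, rfl⟩ := hx
      refine AddSubgroup.subset_closure ⟨s • c, r, m, ?_⟩
      rw [smul_sub, TensorProduct.smul_tmul', TensorProduct.smul_tmul', smul_comm]
    | zero => rw [smul_zero]; exact zero_mem _
    | add x y _ _ hx hy => rw [smul_add]; exact add_mem hx hy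
    | neg x _ hx => rw [smul_neg]; exact neg_mem hx

/-- The tensor product `C ⊗_R M` of the bimodule `C` with the left `R`-module `M`, over the
not necessarily commutative ring `R`, as a left `S`-module. -/
abbrev BalTensor : Type u := (C ⊗[ℤ] M) ⧸ balancedRelations R S C M

/-- The pure tensor `c ⊗ m` in `C ⊗_R M`. -/
def BalTensor.tmul {M : Type u} [AddCommGroup M] [Module R M] (c : C) (m : M) :
    BalTensor R S C M :=
  Submodule.Quotient.mk (c ⊗ₜ[ℤ] m)

theorem BalTensor.smul_tmul {M : Type u} [AddCommGroup M] [Module R M] (c : C) (r : R) (m : M) :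
    BalTensor.tmul R S C (MulOpposite.op r • c) m = BalTensor.tmul R S C c (r • m) :=
  (Submodule.Quotient.eq _).2 (AddSubgroup.subset_closure ⟨c, r, m, rfl⟩)

variable {M} in
/-- The map `C ⊗_R f`, sending `c ⊗ m` to `c ⊗ f m`. -/
def BalTensor.map {N : Type u} [AddCommGroup N] [Module R N] (f : M →ₗ[R] N) :
    BalTensor R S C M →ₗ[S] BalTensor R S C N :=
  (balancedRelations R S C M).mapQ (balancedRelations R S C N)
    (TensorProduct.AlgebraTensorModule.lTensor S C f.toAddMonoidHom.toIntLinearMap) (by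
      intro x hx
      change x ∈ AddSubgroup.closure _ at hx
      rw [Submodule.mem_comap]
      induction hx using AddSubgroup.closure_induction with
      | mem x hx =>
        obtain ⟨c, r, m, rfl⟩ := hx
        refine AddSubgroup.subset_closure ⟨c, r, f m, ?_⟩
        simp
      | zero => rw [map_zero]; exact zero_mem _
      | add x y _ _ hx hy => rw [map_add]; exact add_mem hx hy
      | neg x _ hx => rw [map_neg]; exact neg_mem hx)

@[simp]
theorem BalTensor.map_tmul {M N : Type u} [AddCommGroup M] [Module R M] [AddCommGroup N]
    [Module R N] (f : M →ₗ[R] N) (c : C) (m : M) :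
    BalTensor.map R S C f (BalTensor.tmul R S C c m) = BalTensor.tmul R S C c (f m) := by
  simp [BalTensor.map, BalTensor.tmul]

variable {R S C M} in
theorem BalTensor.hom_ext {P : Type u} [AddCommGroup P] [Module S P]
    {f g : BalTensor R S C M →ₗ[S] P}
    (h : ∀ c m, f (BalTensor.tmul R S C c m) = g (BalTensor.tmul R S C c m)) : f = g := by
  refine LinearMap.ext fun x => ?_
  induction x using Submodule.Quotient.induction_on with
  | H x =>
    induction x using TensorProduct.induction_on with
    | zero => simp
    | tmul c m => exact h c m
    | add x y hx hy => rw [Submodule.Quotient.mk_add, map_add, map_add, hx, hy]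

end Tensor

/-- The functor `C ⊗_R -` from left `R`-modules to left `S`-modules. -/
def tensorFunctor : ModuleCat.{u} R ⥤ ModuleCat.{u} S where
  obj M := ModuleCat.of S (BalTensor R S C M)
  map f := ModuleCat.ofHom (BalTensor.map R S C f.hom)
  map_id M := by
    ext1
    exact BalTensor.hom_ext fun c m => by simp
  map_comp f g := by
    ext1
    exact BalTensor.hom_ext fun c m => by simp

instance : (tensorFunctor R S C).Additive where
  map_add {M N f g} := by
    ext1
    refine BalTensor.hom_ext fun c m => ?_
    exact congrArg (Submodule.Quotient.mk (p := balancedRelations R S C N))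
      (TensorProduct.tmul_add c (f.hom m) (g.hom m))

/-- `Tor_i^R (C, M)`, the `i`-th left derived functor of `C ⊗_R -` evaluated at `M`. -/
noncomputable def tor (i : ℕ) (M : Type u) [AddCommGroup M] [Module R M] : ModuleCat.{u} S :=
  ((tensorFunctor R S C).leftDerived i).obj (ModuleCat.of R M)

/-- The abelian group `Hom_S (C, X)`, carrying the left `R`-module structure
`(r f) c = f (c r)`. -/
def BimodHom (_R S C : Type u) [Ring S] [AddCommGroup C] [Module S C]
    (X : Type u) [AddCommGroup X] [Module S X] : Type u := C →ₗ[S] X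

section Hom

variable (X : Type u) [AddCommGroup X] [Module S X]

instance : AddCommGroup (BimodHom R S C X) := inferInstanceAs (AddCommGroup (C →ₗ[S] X))

instance : FunLike (BimodHom R S C X) C X := inferInstanceAs (FunLike (C →ₗ[S] X) C X)

/-- Right multiplication `c ↦ c r` on `C`, as an `S`-linear map. -/
def rightMul (r : R) : C →ₗ[S] C where
  toFun c := MulOpposite.op r • c
  map_add' := smul_add _
  map_smul' s c := (smul_comm s (MulOpposite.op r) c).symm

instance : Module R (BimodHom R S C X) where
  smul r f := LinearMap.comp (show C →ₗ[S] X from f) (rightMul R S C r)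
  one_smul f := LinearMap.ext fun c => congrArg f (one_smul Rᵐᵒᵖ c)
  mul_smul r r' f := LinearMap.ext fun c =>
    congrArg f (mul_smul (MulOpposite.op r') (MulOpposite.op r) c)
  smul_zero _ := LinearMap.ext fun _ => rfl
  smul_add _ _ _ := LinearMap.ext fun _ => rfl
  add_smul r r' f := LinearMap.ext fun c =>
    (congrArg f (add_smul (MulOpposite.op r) (MulOpposite.op r') c)).trans
      (LinearMap.map_add (show C →ₗ[S] X from f) _ _)
  zero_smul f := LinearMap.ext fun c =>
    (congrArg f (zero_smul Rᵐᵒᵖ c)).trans (LinearMap.map_zero (show C →ₗ[S] X from f))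

theorem BimodHom.smul_apply (r : R) (f : BimodHom R S C X) (c : C) :
    (r • f) c = f (MulOpposite.op r • c) := rfl

end Hom

/-- Left multiplication `c ↦ s c` on `C`, as a homomorphism of right `R`-modules. -/
def leftMul (s : S) : C →ₗ[Rᵐᵒᵖ] C where
  toFun c := s • c
  map_add' := smul_add _
  map_smul' r c := smul_comm s r c

/-- `C` is a semidualizing `(S, R)`-bimodule. -/
structure IsSemidualizing : Prop where
  resolution_left : HasDegreewiseFiniteProjectiveResolution S C
  resolution_right : HasDegreewiseFiniteProjectiveResolution Rᵐᵒᵖ C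
  /-- the homothety map `S → Hom_{Rᵒᵖ} (C, C)` is an isomorphism -/
  homothety_left : Function.Bijective (leftMul R S C)
  /-- the homothety map `R → Hom_S (C, C)` is an isomorphism -/
  homothety_right : Function.Bijective (rightMul R S C)
  ext_left : ExtVanishes S C C
  ext_right : ExtVanishes Rᵐᵒᵖ C C

/-- `C` is a faithfully semidualizing `(S, R)`-bimodule. -/
structure IsFaithfullySemidualizing : Prop extends IsSemidualizing R S C where
  faithful_left : ∀ (N : Type u) [AddCommGroup N] [Module S N],
    Subsingleton (C →ₗ[S] N) → Subsingleton N
  faithful_right : ∀ (M : Type u) [AddCommGroup M] [Module Rᵐᵒᵖ M],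
    Subsingleton (C →ₗ[Rᵐᵒᵖ] M) → Subsingleton M

variable (M : Type u) [AddCommGroup M] [Module R M]

/-- The natural evaluation homomorphism `M → Hom_S (C, C ⊗_R M)`, `m ↦ (c ↦ c ⊗ m)`. -/
def evaluation : M →ₗ[R] BimodHom R S C (BalTensor R S C M) where
  toFun m := ((balancedRelations R S C M).mkQ.comp
    ((TensorProduct.AlgebraTensorModule.mk ℤ S C M).flip m) : C →ₗ[S] BalTensor R S C M)
  map_add' m m' := LinearMap.ext fun c =>
    congrArg (Submodule.Quotient.mk (p := balancedRelations R S C M))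
      (TensorProduct.tmul_add c m m')
  map_smul' r m := LinearMap.ext fun c => (BalTensor.smul_tmul R S C c r m).symm

theorem evaluation_apply (m : M) (c : C) :
    evaluation R S C M m c = BalTensor.tmul R S C c m := rfl

/-- `M` belongs to the Auslander class of `R` with respect to `C`. -/
structure InAuslanderClass : Prop where
  tor_eq_zero : ∀ i : ℕ, 1 ≤ i → Subsingleton (tor R S C i M)
  ext_eq_zero : ExtVanishes S C (BalTensor R S C M)
  evaluation_bijective : Function.Bijective (evaluation R S C M)

/-- `M` is `C`-`fp_n`-injective: it is isomorphic to `Hom_S (C, X)` for some `fp_n`-injective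
`S`-module `X`. -/
def IsCFpInjective (n : ℕ) : Prop :=
  ∃ X : ModuleCat.{u} S, IsFpInjective S X n ∧ Nonempty (M ≃ₗ[R] BimodHom R S C X)

/-- The `C`-`fp_n`-injective dimension of `M`: the least `k` for which there is an exact sequence
`0 → M → I 0 → ⋯ → I k → 0` with every `I i` being `C`-`fp_n`-injective, and `⊤` if there is
no such `k`. -/
noncomputable def cfpInjectiveDimension (n : ℕ) : ℕ∞ :=
  ⨅ (k : ℕ) (_ : ∃ I : FiniteCoresolution R M k, ∀ i ≤ k, IsCFpInjective R S C (I.X i) n), (k : ℕ∞)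

end Bimodule

end Semidual

/-! The functor `C ⊗_R -` turns the question about `M` into one about the `S`-module `C ⊗_R M`,
where dimension is measured by Ext: each of the conditions is governed by `Ext_S^{k+1}(L, C ⊗_R M) =
0` for all finitely `n`-presented `L` (`HasFpInjectiveDimensionLE`). This vanishing does not depend
on a chosen coresolution, so one good coresolution controls all the others.

Over an `n`-coherent ring, the first syzygy of a finitely `n`-presented module is again finitely
`n`-presented. Hence `fp_n`-injectivity amounts to the vanishing of `Ext^1` on such modules and
forces all higher Ext to vanish, which gives dimension shifting.

Three facts transport this to `R`-modules. `IsSemidualizing.counit_bijective`: `C ⊗_R Hom_S(C, X) ≅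
X` for `X` `fp_n`-injective, so `C ⊗_R -` sends `C`-`fp_n`-injectives to `fp_n`-injectives.
`IsFaithfullySemidualizing.map_injective`: by faithfulness, `C ⊗_R -` preserves injectivity of maps
between modules with bijective evaluation. `InWeakAuslanderClass.of_exact`: the Ext and evaluation
conditions pass to cokernels of monomorphisms. The cosyzygies of a coresolution of `M` therefore
remain in this class, and each one lowers the Ext bound by one. When the bound reaches zero, the
last term is recovered as `Hom_S(C, C ⊗_R -)` of itself. Partial coresolutions exist because `M ≅
Hom_S(C, C ⊗_R M)` embeds in `Hom_S(C, J)` with `J` injective. -/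

namespace Semidual

/-! ### Finite presentations via syzygies and finitely generated projectives. -/

section FiniteType

variable {A : Type u} [Ring A]

/-- `M` is of type `FP n`: it is finitely generated if `n = 0`, and for `n + 1` it is the quotient
of a finitely generated projective module by a submodule of type `FP n`. -/
def IsTypeFP (A : Type u) [Ring A] : ℕ → ∀ (M : Type u) [AddCommGroup M] [Module A M], Prop
  | 0, M, _, _ => Module.Finite A M
  | n + 1, M, _, _ => ∃ (P : ModuleCat.{u} A) (p : P →ₗ[A] M), Module.Finite A P ∧
      Module.Projective A P ∧ Function.Surjective p ∧ IsTypeFP A n (LinearMap.ker p)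

variable {M M' M'' : Type u} [AddCommGroup M] [Module A M] [AddCommGroup M'] [Module A M']
  [AddCommGroup M''] [Module A M'']

theorem IsTypeFP.of_equiv {n : ℕ} (h : IsTypeFP A n M) (e : M ≃ₗ[A] M') : IsTypeFP A n M' := by
  cases n with
  | zero =>
    have : Module.Finite A M := h
    exact Module.Finite.equiv e
  | succ n =>
    obtain ⟨P, p, h₁, h₂, h₃, h₄⟩ := h
    refine ⟨P, e.toLinearMap ∘ₗ p, h₁, h₂, e.surjective.comp h₃, ?_⟩
    rwa [LinearMap.ker_comp_of_ker_eq_bot _ e.ker]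

theorem IsTypeFP.finite {n : ℕ} (h : IsTypeFP A n M) : Module.Finite A M := by
  cases n with
  | zero => exact h
  | succ n =>
    obtain ⟨P, p, h₁, -, h₃, -⟩ := h
    exact Module.Finite.of_surjective p h₃

theorem isTypeFP_of_finite_of_projective [Module.Finite A M] [Module.Projective A M] (n : ℕ) :
    IsTypeFP A n M := by
  suffices H : ∀ (n : ℕ) (N : Type u) [AddCommGroup N] [Module A N] [Module.Finite A N]
      [Module.Projective A N], IsTypeFP A n N from H n M
  intro n
  induction n with
  | zero => intro N _ _ _ _; assumption
  | succ n ih =>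
    intro N _ _ _ _
    refine ⟨ModuleCat.of A N, LinearMap.id, ‹_›, ‹_›, Function.surjective_id, ?_⟩
    have : Subsingleton (LinearMap.ker (LinearMap.id : N →ₗ[A] N)) := by
      rw [LinearMap.ker_id]; infer_instance
    exact ih _

/-- The horseshoe lemma: modules of type `FP n` are closed under extensions. -/
theorem IsTypeFP.of_exact {n : ℕ} {f : M' →ₗ[A] M} {g : M →ₗ[A] M''} (h' : IsTypeFP A n M')
    (h'' : IsTypeFP A n M'') (hf : Function.Injective f) (hfg : Function.Exact f g)
    (hg : Function.Surjective g) : IsTypeFP A n M := by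
  induction n generalizing M M' M'' with
  | zero =>
    have : Module.Finite A M' := h'
    have : Module.Finite A M'' := h''
    exact Module.Finite.of_exact hfg hg
  | succ n ih =>
    obtain ⟨P', p', _, _, hp', hk'⟩ := h'
    obtain ⟨P'', p'', _, _, hp'', hk''⟩ := h''
    obtain ⟨l, hl⟩ := Module.projective_lifting_property g p'' hg
    have hl' (x) : g (l x) = p'' x := LinearMap.congr_fun hl x
    have hgf (x) : g (f x) = 0 := hfg.apply_apply_eq_zero x
    -- `P' × P''` covers `M` by `f ∘ p'` and a lift `l` of `p''`; the kernels then form a short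
    -- exact sequence to which induction applies.
    refine ⟨ModuleCat.of A (P' × P''), (f ∘ₗ p').coprod l,
      inferInstanceAs (Module.Finite A (P' × P'')),
      inferInstanceAs (Module.Projective A (P' × P'')), ?_, ?_⟩
    · intro m
      obtain ⟨y, hy⟩ := hp'' (g m)
      obtain ⟨z, hz⟩ := (hfg (m - l y)).1 (by rw [map_sub, hl', hy, sub_self])
      obtain ⟨x, rfl⟩ := hp' z
      exact ⟨(x, y), by simp [hz]⟩
    · let i : LinearMap.ker p' →ₗ[A] LinearMap.ker ((f ∘ₗ p').coprod l) :=
        ((LinearMap.inl A P' P'').comp (LinearMap.ker p').subtype).codRestrict _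
          fun x => by simp
      let q : LinearMap.ker ((f ∘ₗ p').coprod l) →ₗ[A] LinearMap.ker p'' :=
        ((LinearMap.snd A P' P'').comp (Submodule.subtype _)).codRestrict _ fun x => by
          have h : g (f (p' x.1.1) + l x.1.2) = g 0 := congrArg g x.2
          rwa [map_add, hgf, hl', zero_add, map_zero] at h
      refine ih (f := i) (g := q) hk' hk'' ?_ ?_ ?_
      · intro x y hxy
        exact Subtype.ext (congrArg (fun z => z.1.1) hxy)
      · rintro ⟨⟨x, y⟩, hxy⟩
        constructor
        · intro h
          obtain rfl : y = 0 := congrArg Subtype.val h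
          refine ⟨⟨x, hf ?_⟩, rfl⟩
          simpa using hxy
        · rintro ⟨z, hz⟩
          rw [← hz]
          rfl
      · rintro ⟨y, hy⟩
        obtain ⟨z, hz⟩ := (hfg (l y)).1 (by rw [hl']; exact hy)
        obtain ⟨x, rfl⟩ := hp' z
        exact ⟨⟨(-x, y), by simp [hz]⟩, rfl⟩

theorem IsTypeFP.prod {n : ℕ} (h : IsTypeFP A n M) (h' : IsTypeFP A n M') :
    IsTypeFP A n (M × M') :=
  h.of_exact (f := LinearMap.inl A M M') (g := LinearMap.snd A M M') h' LinearMap.inl_injective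
    Function.Exact.inl_snd LinearMap.snd_surjective

theorem IsTypeFP.pi_fin {n : ℕ} (h : IsTypeFP A n M) (a : ℕ) : IsTypeFP A n (Fin a → M) := by
  induction a with
  | zero => exact isTypeFP_of_finite_of_projective n
  | succ a ih => exact (h.prod ih).of_equiv (Fin.consLinearEquiv A fun _ => M)

/-- A quotient of a module of type `FP (n + 1)` by a submodule of type `FP n` is of type
`FP (n + 1)`. -/
theorem IsTypeFP.of_surjective {n : ℕ} {g : M →ₗ[A] M''} (h : IsTypeFP A (n + 1) M)
    (hg : Function.Surjective g) (hk : IsTypeFP A n (LinearMap.ker g)) :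
    IsTypeFP A (n + 1) M'' := by
  obtain ⟨P, p, h₁, h₂, hp, hkp⟩ := h
  refine ⟨P, g ∘ₗ p, h₁, h₂, hg.comp hp, ?_⟩
  -- `ker (g ∘ p)` is an extension of `ker g` by `ker p`, both of type `FP n`.
  let i : LinearMap.ker p →ₗ[A] LinearMap.ker (g ∘ₗ p) :=
    Submodule.inclusion (LinearMap.ker_le_ker_comp p g)
  let q : LinearMap.ker (g ∘ₗ p) →ₗ[A] LinearMap.ker g :=
    (p.comp (Submodule.subtype _)).codRestrict _ fun x => x.2
  refine hkp.of_exact (f := i) (g := q) hk (Submodule.inclusion_injective _) ?_ ?_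
  · rintro ⟨x, hx⟩
    constructor
    · intro h
      exact ⟨⟨x, congrArg Subtype.val h⟩, rfl⟩
    · rintro ⟨z, hz⟩
      rw [← hz]
      exact Subtype.ext z.2
  · rintro ⟨y, hy⟩
    obtain ⟨x, rfl⟩ := hp y
    exact ⟨⟨x, hy⟩, rfl⟩

theorem IsTypeFP.of_succ {n : ℕ} (h : IsTypeFP A (n + 1) M) : IsTypeFP A n M := by
  induction n generalizing M with
  | zero => exact IsTypeFP.finite h
  | succ n ih =>
    obtain ⟨P, p, h₁, h₂, hp, hk⟩ := h
    exact ⟨P, p, h₁, h₂, hp, ih hk⟩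

/-- Cover `P` by a free module via `q`. Since `q` splits, `ker q` is finitely generated projective,
and the new syzygy is an extension of the old one by `ker q`. -/
theorem IsTypeFP.exists_free {n : ℕ} (h : IsTypeFP A (n + 1) M) :
    ∃ (r : ℕ) (p : (Fin r → A) →ₗ[A] M), Function.Surjective p ∧
      IsTypeFP A n (LinearMap.ker p) := by
  obtain ⟨P, p, _, _, hp, hk⟩ := h
  obtain ⟨r, q, hq⟩ := Module.Finite.exists_fin' A P
  refine ⟨r, p ∘ₗ q, hp.comp hq, ?_⟩
  obtain ⟨s, hs⟩ := Module.projective_lifting_property q LinearMap.id hq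
  have hs' (x) : q (s x) = x := LinearMap.congr_fun hs x
  have hkq : IsTypeFP A n (LinearMap.ker q) := by
    have : Module.Projective A (LinearMap.ker q) := by
      refine Module.Projective.of_split (LinearMap.ker q).subtype
        ((LinearMap.id - s ∘ₗ q).codRestrict _ fun x => by simp [hs']) ?_
      ext x
      simp
    have : Module.Finite A (LinearMap.ker q) := by
      refine Module.Finite.of_surjective
        ((LinearMap.id - s ∘ₗ q).codRestrict (LinearMap.ker q) fun x => by simp [hs']) ?_
      rintro ⟨x, hx⟩
      refine ⟨x, Subtype.ext ?_⟩
      simp [LinearMap.mem_ker.1 hx]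
    exact isTypeFP_of_finite_of_projective n
  let i : LinearMap.ker q →ₗ[A] LinearMap.ker (p ∘ₗ q) :=
    Submodule.inclusion (LinearMap.ker_le_ker_comp q p)
  let g : LinearMap.ker (p ∘ₗ q) →ₗ[A] LinearMap.ker p :=
    (q.comp (Submodule.subtype _)).codRestrict _ fun x => x.2
  refine hkq.of_exact (f := i) (g := g) hk (Submodule.inclusion_injective _) ?_ ?_
  · rintro ⟨x, hx⟩
    constructor
    · intro h
      exact ⟨⟨x, congrArg Subtype.val h⟩, rfl⟩
    · rintro ⟨z, hz⟩
      rw [← hz]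
      exact Subtype.ext z.2
  · rintro ⟨y, hy⟩
    obtain ⟨x, rfl⟩ := hq y
    exact ⟨⟨x, hy⟩, rfl⟩

theorem IsTypeFP.isFinitelyPresented {n : ℕ} (h : IsTypeFP A n M) : IsFinitelyPresented A M n := by
  induction n generalizing M with
  | zero =>
    have : Module.Finite A M := h
    obtain ⟨r, p, hp⟩ := Module.Finite.exists_fin' A M
    exact ⟨fun _ => r, fun _ => 0, p, hp, by simp, by simp⟩
  | succ n ih =>
    obtain ⟨r₀, p, hp, hk⟩ := h.exists_free
    obtain ⟨r, d, q, hq, h₀, hd⟩ := ih hk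
    -- The free cover is prepended to a presentation of its kernel, shifting indices by one.
    refine ⟨fun i => Nat.rec r₀ (fun j _ => r j) i, fun i => match i with
      | 0 => (LinearMap.ker p).subtype ∘ₗ q
      | j + 1 => d j, p, hp, fun _ => ?_, fun i hi => ?_⟩
    · intro x
      constructor
      · intro hx
        obtain ⟨y, hy⟩ := hq ⟨x, hx⟩
        exact ⟨y, congrArg Subtype.val hy⟩
      · rintro ⟨y, rfl⟩
        exact (q y).2
    · cases i with
      | zero =>
        intro x
        refine Iff.trans ?_ (h₀ (by omega) x)
        exact Submodule.coe_eq_zero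
      | succ i => exact hd i (by omega)

theorem IsFinitelyPresented.isTypeFP {n : ℕ} (h : IsFinitelyPresented A M n) :
    IsTypeFP A n M := by
  induction n generalizing M with
  | zero =>
    obtain ⟨r, d, p, hp, -⟩ := h
    exact Module.Finite.of_surjective p hp
  | succ n ih =>
    obtain ⟨r, d, p, hp, h₀, hd⟩ := h
    have h₀ := h₀ (by omega)
    refine ⟨ModuleCat.of A (Fin (r 0) → A), p, inferInstanceAs (Module.Finite A (Fin (r 0) → A)),
      inferInstanceAs (Module.Projective A (Fin (r 0) → A)), hp, ih ?_⟩
    refine ⟨fun i => r (i + 1), fun i => d (i + 1),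
      (d 0).codRestrict (LinearMap.ker p) fun x => h₀.apply_apply_eq_zero x, ?_, fun hn => ?_,
      fun i hi => hd (i + 1) (by omega)⟩
    · rintro ⟨x, hx⟩
      obtain ⟨y, rfl⟩ := (h₀ x).1 hx
      exact ⟨y, rfl⟩
    · intro x
      refine Iff.trans ?_ (hd 0 (by omega) x)
      exact Submodule.coe_eq_zero.symm

theorem HasDegreewiseFiniteProjectiveResolution.isTypeFP
    (h : HasDegreewiseFiniteProjectiveResolution A M) (n : ℕ) : IsTypeFP A n M := by
  induction n generalizing M with
  | zero =>
    obtain ⟨P, d, p, hP, hp, -⟩ := h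
    have := (hP 0).1
    exact Module.Finite.of_surjective p hp
  | succ n ih =>
    obtain ⟨P, d, p, hP, hp, h₀, hd⟩ := h
    refine ⟨P 0, p, (hP 0).1, (hP 0).2, hp, ih ?_⟩
    refine ⟨fun i => P (i + 1), fun i => d (i + 1),
      (d 0).codRestrict (LinearMap.ker p) fun x => h₀.apply_apply_eq_zero x,
      fun i => hP (i + 1), ?_, ?_, fun i => hd (i + 1)⟩
    · rintro ⟨x, hx⟩
      obtain ⟨y, rfl⟩ := (h₀ x).1 hx
      exact ⟨y, rfl⟩
    · intro x
      refine Iff.trans ?_ (hd 0 x)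
      exact Submodule.coe_eq_zero.symm

end FiniteType

/-! ### Long exact sequences of Ext for modules. -/

section Ext

variable {A : Type u} [Ring A]

/-- The group `Ext_A^i (M, N)`. -/
abbrev ModExt (A : Type u) [Ring A] (M N : Type u) [AddCommGroup M] [Module A M] [AddCommGroup N]
    [Module A N] (i : ℕ) : Type u :=
  Abelian.Ext.{u} (ModuleCat.of A M) (ModuleCat.of A N) i

variable {M₁ M₂ M₃ N : Type u} [AddCommGroup M₁] [Module A M₁] [AddCommGroup M₂] [Module A M₂]
  [AddCommGroup M₃] [Module A M₃] [AddCommGroup N] [Module A N]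
  {f : M₁ →ₗ[A] M₂} {g : M₂ →ₗ[A] M₃}

theorem shortExact_of_exact (hf : Function.Injective f) (hfg : Function.Exact f g)
    (hg : Function.Surjective g) :
    (ModuleCat.shortComplexOfCompEqZero f g hfg.linearMap_comp_eq_zero).ShortExact :=
  ModuleCat.shortComplex_shortExact _ hfg hf hg

section

variable (hf : Function.Injective f) (hfg : Function.Exact f g) (hg : Function.Surjective g)

include hf hfg hg

theorem subsingleton_ext_of_covariant₃ {i : ℕ} (h₂ : Subsingleton (ModExt A N M₂ i))
    (h₁ : Subsingleton (ModExt A N M₁ (i + 1))) : Subsingleton (ModExt A N M₃ i) := by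
  refine subsingleton_of_forall_eq 0 fun x => ?_
  obtain ⟨y, rfl⟩ := Abelian.Ext.covariant_sequence_exact₃ (ModuleCat.of A N)
    (shortExact_of_exact hf hfg hg) x rfl (h₁.elim _ _)
  rw [show y = 0 from h₂.elim _ _, Abelian.Ext.zero_comp]

theorem subsingleton_ext_of_covariant₁ {i : ℕ} (h₃ : Subsingleton (ModExt A N M₃ i))
    (h₂ : Subsingleton (ModExt A N M₂ (i + 1))) : Subsingleton (ModExt A N M₁ (i + 1)) := by
  refine subsingleton_of_forall_eq 0 fun x => ?_
  obtain ⟨y, rfl⟩ := Abelian.Ext.covariant_sequence_exact₁ (ModuleCat.of A N)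
    (shortExact_of_exact hf hfg hg) x (h₂.elim _ _) rfl
  rw [show y = 0 from h₃.elim _ _, Abelian.Ext.zero_comp]

theorem subsingleton_ext_of_contravariant₃ {i : ℕ} (h₁ : Subsingleton (ModExt A M₁ N i))
    (h₂ : Subsingleton (ModExt A M₂ N (i + 1))) : Subsingleton (ModExt A M₃ N (i + 1)) := by
  refine subsingleton_of_forall_eq 0 fun x => ?_
  obtain ⟨y, rfl⟩ := Abelian.Ext.contravariant_sequence_exact₃
    (shortExact_of_exact hf hfg hg) (ModuleCat.of A N) x (h₂.elim _ _) (add_comm 1 i)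
  rw [show y = 0 from h₁.elim _ _, Abelian.Ext.comp_zero]

theorem exists_lift_of_subsingleton_ext (h : Subsingleton (ModExt A N M₁ 1)) (φ : N →ₗ[A] M₃) :
    ∃ ψ : N →ₗ[A] M₂, g ∘ₗ ψ = φ := by
  obtain ⟨y, hy⟩ := Abelian.Ext.covariant_sequence_exact₃ (ModuleCat.of A N)
    (shortExact_of_exact hf hfg hg) (Abelian.Ext.mk₀ (ModuleCat.ofHom φ)) (zero_add 1)
    (h.elim _ _)
  obtain ⟨ψ, rfl⟩ := (Abelian.Ext.mk₀_bijective _ _).2 y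
  rw [Abelian.Ext.mk₀_comp_mk₀] at hy
  exact ⟨ψ.hom, congrArg ModuleCat.Hom.hom ((Abelian.Ext.mk₀_bijective _ _).1 hy)⟩

theorem exists_extension_of_subsingleton_ext (h : Subsingleton (ModExt A M₃ N 1))
    (φ : M₁ →ₗ[A] N) : ∃ ψ : M₂ →ₗ[A] N, ψ ∘ₗ f = φ := by
  obtain ⟨y, hy⟩ := Abelian.Ext.contravariant_sequence_exact₁
    (shortExact_of_exact hf hfg hg) (ModuleCat.of A N) (Abelian.Ext.mk₀ (ModuleCat.ofHom φ))
    (add_zero 1) (h.elim _ _)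
  obtain ⟨ψ, rfl⟩ := (Abelian.Ext.mk₀_bijective _ _).2 y
  rw [Abelian.Ext.mk₀_comp_mk₀] at hy
  exact ⟨ψ.hom, congrArg ModuleCat.Hom.hom ((Abelian.Ext.mk₀_bijective _ _).1 hy)⟩

/-- The connecting map `Hom(M₁, N) → Ext^1(M₃, N)` is onto because `Ext^1(M₂, N) = 0`, and it kills
every map that factors through `f`. -/
theorem subsingleton_ext_one_of_exists_extension (h₂ : Subsingleton (ModExt A M₂ N 1))
    (H : ∀ φ : M₁ →ₗ[A] N, ∃ ψ : M₂ →ₗ[A] N, ψ ∘ₗ f = φ) : Subsingleton (ModExt A M₃ N 1) := by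
  refine subsingleton_of_forall_eq 0 fun x => ?_
  have hS := shortExact_of_exact hf hfg hg
  obtain ⟨y, rfl⟩ := Abelian.Ext.contravariant_sequence_exact₃
    hS (ModuleCat.of A N) x (h₂.elim _ _) (add_zero 1)
  obtain ⟨φ, rfl⟩ := (Abelian.Ext.mk₀_bijective _ _).2 y
  obtain ⟨ψ, hψ⟩ := H φ.hom
  have hφ : φ = ModuleCat.ofHom f ≫ ModuleCat.ofHom ψ := by
    ext1
    exact hψ.symm
  rw [hφ, ← Abelian.Ext.mk₀_comp_mk₀]
  exact hS.extClass_comp_assoc _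

end

theorem subsingleton_ext_of_projective [Module.Projective A N] (i : ℕ) :
    Subsingleton (ModExt A N M₁ (i + 1)) := by
  have : Projective (ModuleCat.of A N) := (IsProjective.iff_projective N).1 ‹_›
  exact Abelian.Ext.subsingleton_of_projective _ _ i

end Ext

/-! ### `fp_n`-injectivity and dimension shifting over an `n`-coherent ring. -/

section FpInjective

variable {A : Type u} [Ring A] {X N : Type u} [AddCommGroup X] [Module A X] [AddCommGroup N]
  [Module A N] {n : ℕ}

theorem IsFpInjective.of_equiv (h : IsFpInjective A X n) (e : X ≃ₗ[A] N) :
    IsFpInjective A N n := by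
  intro K L _ _ _ _ hK hL j hj φ
  obtain ⟨ψ, hψ⟩ := h K L hK hL j hj (e.symm.toLinearMap ∘ₗ φ)
  refine ⟨e.toLinearMap ∘ₗ ψ, LinearMap.ext fun x => ?_⟩
  have := LinearMap.congr_fun hψ x
  simpa using congrArg e this

theorem isFpInjective_of_injective [Module.Injective A X] (n : ℕ) : IsFpInjective A X n :=
  fun K L _ _ _ _ _ _ j hj φ => Module.Injective.extension_property A X K L j hj φ

theorem isFpInjective_of_subsingleton [Subsingleton X] (n : ℕ) : IsFpInjective A X n :=
  fun _ _ _ _ _ _ _ _ _ _ _ => ⟨0, LinearMap.ext fun _ => Subsingleton.elim _ _⟩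

/-- `Ext_A^{k + 1} (L, X) = 0` for all finitely `n`-presented `L`. -/
def HasFpInjectiveDimensionLE (A : Type u) [Ring A] (n k : ℕ) (X : Type u) [AddCommGroup X]
    [Module A X] : Prop :=
  ∀ (L : Type u) [AddCommGroup L] [Module A L], IsFinitelyPresented A L n →
    Subsingleton (ModExt A L X (k + 1))

variable (hA : IsNCoherent A n)

-- Coherence enters here: the extra step of presentation makes the syzygy lie in the same class as
-- `L`, so inductions over syzygies can continue.
include hA in
theorem IsNCoherent.exists_presentation {L : Type u} [AddCommGroup L] [Module A L]
    (hL : IsFinitelyPresented A L n) : ∃ (r : ℕ) (p : (Fin r → A) →ₗ[A] L),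
      Function.Surjective p ∧ IsFinitelyPresented A (LinearMap.ker p) n := by
  obtain ⟨r, p, hp, hk⟩ := (hA L hL).isTypeFP.exists_free
  exact ⟨r, p, hp, hk.isFinitelyPresented⟩

theorem isFinitelyPresented_of_projective [Module.Finite A N] [Module.Projective A N] (n : ℕ) :
    IsFinitelyPresented A N n :=
  (isTypeFP_of_finite_of_projective n).isFinitelyPresented

theorem IsFinitelyPresented.quotient_range {K L : Type u} [AddCommGroup K] [Module A K]
    [AddCommGroup L] [Module A L] (hn : 1 ≤ n) (hK : IsFinitelyPresented A K n)
    (hL : IsFinitelyPresented A L n) {j : K →ₗ[A] L} (hj : Function.Injective j) :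
    IsFinitelyPresented A (L ⧸ LinearMap.range j) n := by
  obtain ⟨n, rfl⟩ := Nat.exists_eq_add_of_le' hn
  refine (hL.isTypeFP.of_surjective (LinearMap.range j).mkQ_surjective ?_).isFinitelyPresented
  rw [Submodule.ker_mkQ]
  exact hK.isTypeFP.of_succ.of_equiv (LinearEquiv.ofInjective j hj)

-- In degree one, maps extend along the inclusion of the syzygy in a free module; higher degrees
-- reduce to the syzygy.
include hA in
theorem IsFpInjective.subsingleton_ext (hX : IsFpInjective A X n) {L : Type u} [AddCommGroup L]
    [Module A L] (hL : IsFinitelyPresented A L n) (i : ℕ) :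
    Subsingleton (ModExt A L X (i + 1)) := by
  induction i generalizing L with
  | zero =>
    obtain ⟨r, p, hp, hk⟩ := hA.exists_presentation hL
    exact subsingleton_ext_one_of_exists_extension (Submodule.subtype_injective _)
      (LinearMap.exact_subtype_ker_map p) hp (subsingleton_ext_of_projective 0)
      (hX _ _ hk (isFinitelyPresented_of_projective n) _ (Submodule.subtype_injective _))
  | succ i ih =>
    obtain ⟨r, p, hp, hk⟩ := hA.exists_presentation hL
    exact subsingleton_ext_of_contravariant₃ (Submodule.subtype_injective _)
      (LinearMap.exact_subtype_ker_map p) hp (ih hk) (subsingleton_ext_of_projective _)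

/-- The obstruction to extending from `K` to `L` lies in `Ext^1(L / K, X)`, and `L / K` is again
finitely `n`-presented. -/
theorem isFpInjective_of_hasFpInjectiveDimensionLE_zero (hn : 1 ≤ n)
    (hX : HasFpInjectiveDimensionLE A n 0 X) : IsFpInjective A X n :=
  fun _ _ _ _ _ _ hK hL j hj φ => exists_extension_of_subsingleton_ext hj
    (LinearMap.exact_map_mkQ_range j) (Submodule.mkQ_surjective _)
    (hX _ (hK.quotient_range hn hL hj)) φ

variable {Y Z : Type u} [AddCommGroup Y] [Module A Y] [AddCommGroup Z] [Module A Z]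
  {f : X →ₗ[A] Y} {g : Y →ₗ[A] Z}

include hA in
theorem hasFpInjectiveDimensionLE_succ_iff (hf : Function.Injective f) (hfg : Function.Exact f g)
    (hg : Function.Surjective g) (hY : IsFpInjective A Y n) (k : ℕ) :
    HasFpInjectiveDimensionLE A n (k + 1) X ↔ HasFpInjectiveDimensionLE A n k Z :=
  ⟨fun h L _ _ hL => subsingleton_ext_of_covariant₃ hf hfg hg (hY.subsingleton_ext hA hL k)
    (h L hL), fun h L _ _ hL => subsingleton_ext_of_covariant₁ hf hfg hg (h L hL)
    (hY.subsingleton_ext hA hL (k + 1))⟩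

end FpInjective

/-! ### The balanced tensor product, its right exactness, unit and counit. -/

section Tensor

variable {R S C : Type u} [Ring R] [Ring S] [AddCommGroup C] [Module S C] [Module Rᵐᵒᵖ C]
  [SMulCommClass S Rᵐᵒᵖ C] {M M' M'' : Type u} [AddCommGroup M] [Module R M] [AddCommGroup M']
  [Module R M'] [AddCommGroup M''] [Module R M'']

@[elab_as_elim]
theorem BalTensor.induction_on {p : BalTensor R S C M → Prop} (x : BalTensor R S C M)
    (zero : p 0) (tmul : ∀ c m, p (BalTensor.tmul R S C c m))
    (add : ∀ x y, p x → p y → p (x + y)) : p x := by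
  induction x using Submodule.Quotient.induction_on with
  | H x =>
    induction x using TensorProduct.induction_on with
    | zero => exact zero
    | tmul c m => exact tmul c m
    | add x y hx hy => exact add _ _ hx hy

theorem BalTensor.map_comp (g : M' →ₗ[R] M'') (f : M →ₗ[R] M') :
    BalTensor.map R S C (g ∘ₗ f) = BalTensor.map R S C g ∘ₗ BalTensor.map R S C f :=
  BalTensor.hom_ext fun c m => by simp

theorem BalTensor.map_id :
    BalTensor.map R S C (LinearMap.id : M →ₗ[R] M) = LinearMap.id :=
  BalTensor.hom_ext fun c m => by simp

/-- The map `m ↦ c ⊗ m`. -/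
def BalTensor.tmulHom (R S : Type u) [Ring R] [Ring S] [Module S C] [Module Rᵐᵒᵖ C]
    [SMulCommClass S Rᵐᵒᵖ C] {M : Type u} [AddCommGroup M] [Module R M] (c : C) :
    M →+ BalTensor R S C M :=
  AddMonoidHom.mk' (BalTensor.tmul R S C c) fun m m' =>
    congrArg (Submodule.Quotient.mk (p := balancedRelations R S C M))
      (TensorProduct.tmul_add c m m')

theorem BalTensor.tmul_sum {ι : Type*} (s : Finset ι) (c : C) (m : ι → M) :
    BalTensor.tmul R S C c (∑ i ∈ s, m i) = ∑ i ∈ s, BalTensor.tmul R S C c (m i) :=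
  map_sum (BalTensor.tmulHom R S c) m s

theorem BalTensor.tmul_add (c : C) (m m' : M) :
    BalTensor.tmul R S C c (m + m') = BalTensor.tmul R S C c m + BalTensor.tmul R S C c m' :=
  map_add (BalTensor.tmulHom R S c) m m'

theorem BalTensor.tmul_zero (c : C) : BalTensor.tmul R S C c (0 : M) = 0 :=
  map_zero (BalTensor.tmulHom R S c)

/-- The isomorphism `C ⊗_R M ≃ C ⊗_R M'` induced by an isomorphism `M ≃ M'`. -/
def BalTensor.congr (e : M ≃ₗ[R] M') : BalTensor R S C M ≃ₗ[S] BalTensor R S C M' :=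
  LinearEquiv.ofLinearMap (BalTensor.map R S C e.toLinearMap)
    (BalTensor.map R S C e.symm.toLinearMap)
    (by rw [← BalTensor.map_comp, LinearEquiv.comp_symm, BalTensor.map_id])
    (by rw [← BalTensor.map_comp, LinearEquiv.symm_comp, BalTensor.map_id])

theorem BalTensor.map_surjective {g : M' →ₗ[R] M''} (hg : Function.Surjective g) :
    Function.Surjective (BalTensor.map R S C g) := by
  intro x
  induction x using BalTensor.induction_on with
  | zero => exact ⟨0, map_zero _⟩
  | tmul c m =>
    obtain ⟨m, rfl⟩ := hg m
    exact ⟨BalTensor.tmul R S C c m, BalTensor.map_tmul R S C g c m⟩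
  | add x y hx hy =>
    obtain ⟨x, rfl⟩ := hx
    obtain ⟨y, rfl⟩ := hy
    exact ⟨x + y, map_add _ _ _⟩

/-- Generating relations lift one by one along `g`. This reduces right exactness over `R` to right
exactness over `ℤ`. -/
theorem exists_mem_balancedRelations {g : M' →ₗ[R] M''} (hg : Function.Surjective g)
    {x : C ⊗[ℤ] M''} (hx : x ∈ balancedRelations R S C M'') :
    ∃ y ∈ balancedRelations R S C M',
      TensorProduct.AlgebraTensorModule.lTensor S C g.toAddMonoidHom.toIntLinearMap y = x := by
  change x ∈ AddSubgroup.closure _ at hx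
  induction hx using AddSubgroup.closure_induction with
  | mem x hx =>
    obtain ⟨c, r, m, rfl⟩ := hx
    obtain ⟨m, rfl⟩ := hg m
    refine ⟨_, AddSubgroup.subset_closure ⟨c, r, m, rfl⟩, ?_⟩
    simp
  | zero => exact ⟨0, zero_mem _, map_zero _⟩
  | add x y _ _ hx hy =>
    obtain ⟨x, hx, rfl⟩ := hx
    obtain ⟨y, hy, rfl⟩ := hy
    exact ⟨x + y, add_mem hx hy, map_add _ _ _⟩
  | neg x _ hx =>
    obtain ⟨x, hx, rfl⟩ := hx
    exact ⟨-x, neg_mem hx, map_neg _ _⟩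

/-- The functor `C ⊗_R -` is right exact. -/
theorem BalTensor.map_exact {f : M →ₗ[R] M'} {g : M' →ₗ[R] M''} (hfg : Function.Exact f g)
    (hg : Function.Surjective g) :
    Function.Exact (BalTensor.map R S C f) (BalTensor.map R S C g) := by
  intro x
  constructor
  · intro hx
    induction x using Submodule.Quotient.induction_on with
    | H x =>
      obtain ⟨y, hy, hyx⟩ := exists_mem_balancedRelations hg
        ((Submodule.Quotient.mk_eq_zero _).1 hx)
      -- Subtracting the lifted relation `y` leaves the class of `x` unchanged and puts the
      -- representative in the kernel over `ℤ`.
      obtain ⟨z, hz⟩ := (lTensor_exact C (f := f.toAddMonoidHom.toIntLinearMap)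
        (g := g.toAddMonoidHom.toIntLinearMap) hfg hg (x - y)).1
        (by rw [map_sub]; exact sub_eq_zero.2 hyx.symm)
      refine ⟨Submodule.Quotient.mk z, (Submodule.Quotient.eq _).2 ?_⟩
      change LinearMap.lTensor C f.toAddMonoidHom.toIntLinearMap z - x ∈ _
      rw [hz, sub_sub_cancel_left]
      exact neg_mem hy
  · rintro ⟨y, rfl⟩
    rw [← LinearMap.comp_apply, ← BalTensor.map_comp, hfg.linearMap_comp_eq_zero]
    induction y using BalTensor.induction_on with
    | zero => exact map_zero _
    | tmul c m =>
      rw [BalTensor.map_tmul]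
      exact BalTensor.tmul_zero c
    | add x y hx hy => rw [map_add, hx, hy, add_zero]

/-- The map `c ↦ c ⊗ m`, as an `S`-linear map. -/
def evaluationAt (R S C : Type u) [Ring R] [Ring S] [AddCommGroup C] [Module S C] [Module Rᵐᵒᵖ C]
    [SMulCommClass S Rᵐᵒᵖ C] {M : Type u} [AddCommGroup M] [Module R M] (m : M) :
    C →ₗ[S] BalTensor R S C M :=
  evaluation R S C M m

@[simp]
theorem evaluationAt_apply (m : M) (c : C) :
    evaluationAt R S C m c = BalTensor.tmul R S C c m := rfl

theorem BalTensor.sum_tmul {ι : Type*} (s : Finset ι) (c : ι → C) (m : M) :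
    BalTensor.tmul R S C (∑ i ∈ s, c i) m = ∑ i ∈ s, BalTensor.tmul R S C (c i) m :=
  map_sum (evaluationAt R S C m) c s

theorem BalTensor.zero_tmul (m : M) : BalTensor.tmul R S C 0 m = 0 :=
  map_zero (evaluationAt R S C m)

theorem map_comp_evaluationAt (f : M →ₗ[R] M') (m : M) :
    BalTensor.map R S C f ∘ₗ evaluationAt R S C m = evaluationAt R S C (f m) :=
  LinearMap.ext fun c => BalTensor.map_tmul R S C f c m

theorem evaluationAt_injective (h : Function.Bijective (evaluation R S C M)) {m m' : M}
    (hm : evaluationAt R S C m = evaluationAt R S C m') : m = m' :=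
  h.1 hm

theorem evaluationAt_surjective (h : Function.Bijective (evaluation R S C M))
    (φ : C →ₗ[S] BalTensor R S C M) : ∃ m, evaluationAt R S C m = φ :=
  h.2 φ

variable {X Y : Type u} [AddCommGroup X] [Module S X] [AddCommGroup Y] [Module S Y]

/-- The map `Hom_S (C, X) → Hom_S (C, Y)` induced by `g : X → Y`. -/
def BimodHom.map (R : Type u) [Ring R] [Module Rᵐᵒᵖ C] [SMulCommClass S Rᵐᵒᵖ C] (g : X →ₗ[S] Y) :
    BimodHom R S C X →ₗ[R] BimodHom R S C Y where
  toFun f := g ∘ₗ (show C →ₗ[S] X from f)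
  map_add' f f' := LinearMap.comp_add (show C →ₗ[S] X from f) (show C →ₗ[S] X from f') g
  map_smul' _ _ := rfl

variable (R S C X) in
/-- The natural map `C ⊗_R Hom_S (C, X) → X`, sending `c ⊗ f` to `f c`. -/
def counit : BalTensor R S C (BimodHom R S C X) →ₗ[S] X :=
  (balancedRelations R S C (BimodHom R S C X)).liftQ
    (TensorProduct.AlgebraTensorModule.lift
      { toFun := fun c =>
          { toFun := fun f : BimodHom R S C X => (show C →ₗ[S] X from f) c
            map_add' := fun _ _ => rfl
            map_smul' := fun r f => LinearMap.smul_apply r (show C →ₗ[S] X from f) c }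
        map_add' := fun c c' => LinearMap.ext fun f => map_add (show C →ₗ[S] X from f) c c'
        map_smul' := fun s c => LinearMap.ext fun f => map_smul (show C →ₗ[S] X from f) s c }) (by
    intro x hx
    change x ∈ AddSubgroup.closure _ at hx
    rw [LinearMap.mem_ker]
    induction hx using AddSubgroup.closure_induction with
    | mem x hx =>
      obtain ⟨c, r, f, rfl⟩ := hx
      rw [map_sub, sub_eq_zero]
      rfl
    | zero => exact map_zero _
    | add x y _ _ hx hy => rw [map_add, hx, hy, add_zero]
    | neg x _ hx => rw [map_neg, hx, neg_zero])

/-- Triangle identity: `Hom_S(C, counit)` composed with the evaluation is the identity,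
definitionally. -/
theorem evaluation_bimodHom_bijective (h : Function.Bijective (counit R S C X)) :
    Function.Bijective (evaluation R S C (BimodHom R S C X)) := by
  refine ⟨fun f g hfg => ?_, fun φ => ⟨BimodHom.map R (counit R S C X) φ, ?_⟩⟩
  · exact congrArg (BimodHom.map R (counit R S C X)) hfg
  · refine LinearMap.ext fun c => h.1 ?_
    rfl

theorem evaluation_bijective_of_equiv (e : M ≃ₗ[R] M')
    (h : Function.Bijective (evaluation R S C M')) : Function.Bijective (evaluation R S C M) := by
  refine ⟨fun m m' (hm : evaluationAt R S C m = evaluationAt R S C m') =>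
    e.injective (evaluationAt_injective h ?_), fun φ => ?_⟩
  · change evaluationAt R S C (e.toLinearMap m) = evaluationAt R S C (e.toLinearMap m')
    rw [← map_comp_evaluationAt, ← map_comp_evaluationAt, hm]
  · obtain ⟨m', hm'⟩ := evaluationAt_surjective h
      ((BalTensor.congr e).toLinearMap ∘ₗ (show C →ₗ[S] BalTensor R S C M from φ))
    refine ⟨e.symm.toLinearMap m', ?_⟩
    change evaluationAt R S C _ = _
    rw [← map_comp_evaluationAt, hm']
    exact LinearMap.ext fun c => (BalTensor.congr e).symm_apply_apply _

end Tensor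

/-! ### Bijectivity of the counit on `fp_n`-injective modules. -/

section Counit

variable {R S C : Type u} [Ring R] [Ring S] [AddCommGroup C] [Module S C] [Module Rᵐᵒᵖ C]
  [SMulCommClass S Rᵐᵒᵖ C]

omit [Ring R] [Module Rᵐᵒᵖ C] [SMulCommClass S Rᵐᵒᵖ C] in
theorem BimodHom.sum_apply {X : Type u} [AddCommGroup X] [Module S X] {ι : Type*} (s : Finset ι)
    (f : ι → BimodHom R S C X) (c : C) : (∑ i ∈ s, f i) c = ∑ i ∈ s, f i c :=
  LinearMap.sum_apply s (fun i => (show C →ₗ[S] X from f i)) c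

section Presentation

variable {a b : ℕ}

variable (S) in
/-- The map `S → C ^ a`, `s ↦ (s c₁, …, s cₐ)`. -/
def generatorMap (c : Fin a → C) : S →ₗ[S] (Fin a → C) :=
  LinearMap.pi fun i => LinearMap.toSpanSingleton S C (c i)

theorem generatorMap_apply (c : Fin a → C) (s : S) (i : Fin a) :
    generatorMap S c s i = s • c i := rfl

theorem generatorMap_one (c : Fin a → C) : generatorMap S c 1 = c :=
  funext fun i => one_smul S (c i)

variable (S C) in
/-- The map `C ^ a → C ^ b` given by right multiplication with a matrix over `R`. -/
def matrixMap (ρ : Fin b → Fin a → Rᵐᵒᵖ) : (Fin a → C) →ₗ[S] (Fin b → C) :=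
  LinearMap.pi fun j => ∑ i, rightMul R S C (ρ j i).unop ∘ₗ LinearMap.proj i

theorem matrixMap_apply (ρ : Fin b → Fin a → Rᵐᵒᵖ) (x : Fin a → C) (j : Fin b) :
    matrixMap S C ρ x j = ∑ i, ρ j i • x i := by
  simp [matrixMap, rightMul]

variable {d : (Fin b → Rᵐᵒᵖ) →ₗ[Rᵐᵒᵖ] (Fin a → Rᵐᵒᵖ)} {c : Fin a → C}

/-- An element of `S` acts on `C` through an `Rᵐᵒᵖ`-linear map, which is determined on generators.
-/
theorem generatorMap_injective (h : Function.Injective (leftMul R S C))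
    (hc : Function.Surjective (Fintype.linearCombination Rᵐᵒᵖ c)) :
    Function.Injective (generatorMap S c) := by
  intro s t hst
  refine h (LinearMap.ext fun x => ?_)
  obtain ⟨y, rfl⟩ := hc x
  rw [Fintype.linearCombination_apply, map_sum, map_sum]
  refine Finset.sum_congr rfl fun i _ => ?_
  rw [map_smul, map_smul]
  exact congrArg (y i • ·) (congrFun hst i)

/-- Applying `Hom_{Rᵒᵖ} (-, C)` to a presentation of `C` gives an exact sequence
`S → C ^ a → C ^ b`. -/
theorem generatorMap_matrixMap_exact (h : Function.Surjective (leftMul R S C))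
    (hc : Function.Surjective (Fintype.linearCombination Rᵐᵒᵖ c))
    (hd : Function.Exact d (Fintype.linearCombination Rᵐᵒᵖ c)) :
    Function.Exact (generatorMap S c) (matrixMap S C fun j => d (Pi.single j 1)) := by
  intro x
  constructor
  · intro hx
    have hle : LinearMap.ker (Fintype.linearCombination Rᵐᵒᵖ c) ≤
        LinearMap.ker (Fintype.linearCombination Rᵐᵒᵖ x) := by
      rw [hd.linearMap_ker_eq, LinearMap.range_le_ker_iff]
      refine LinearMap.pi_ext' fun j => LinearMap.ext_ring ?_
      exact (matrixMap_apply (S := S) _ x j).symm.trans (congrFun hx j)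
    -- As `x` satisfies all relations among the `c i`, the assignment `c i ↦ x i` defines an
    -- endomorphism of `C`, which is multiplication by some `s`.
    let ψ : C →ₗ[Rᵐᵒᵖ] C := (LinearMap.ker (Fintype.linearCombination Rᵐᵒᵖ c)).liftQ _ hle ∘ₗ
      (LinearMap.quotKerEquivOfSurjective _ hc).symm.toLinearMap
    have hψ (y) : ψ (Fintype.linearCombination Rᵐᵒᵖ c y) = Fintype.linearCombination Rᵐᵒᵖ x y := by
      have : (LinearMap.quotKerEquivOfSurjective _ hc).symm (Fintype.linearCombination Rᵐᵒᵖ c y) =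
          Submodule.Quotient.mk y := (LinearEquiv.symm_apply_eq _).2 rfl
      change Submodule.liftQ _ _ hle ((LinearMap.quotKerEquivOfSurjective _ hc).symm _) = _
      rw [this]
      rfl
    obtain ⟨s, hs⟩ := h ψ
    refine ⟨s, funext fun i => ?_⟩
    have := hψ (Pi.single i 1)
    rw [Fintype.linearCombination_apply_single, Fintype.linearCombination_apply_single, one_smul,
      one_smul, ← hs] at this
    exact this
  · rintro ⟨s, rfl⟩
    funext j
    rw [matrixMap_apply]
    simp_rw [generatorMap_apply, ← smul_comm s, ← Finset.smul_sum]
    rw [← Fintype.linearCombination_apply, hd.apply_apply_eq_zero, smul_zero, Pi.zero_apply]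

theorem BalTensor.exists_eq_sum {M : Type u} [AddCommGroup M] [Module R M]
    (hc : Function.Surjective (Fintype.linearCombination Rᵐᵒᵖ c)) (z : BalTensor R S C M) :
    ∃ m : Fin a → M, z = ∑ i, BalTensor.tmul R S C (c i) (m i) := by
  induction z using BalTensor.induction_on with
  | zero => exact ⟨0, by simp [BalTensor.tmul_zero]⟩
  | tmul x m =>
    obtain ⟨y, rfl⟩ := hc x
    refine ⟨fun i => (y i).unop • m, ?_⟩
    rw [Fintype.linearCombination_apply, BalTensor.sum_tmul]
    exact Finset.sum_congr rfl fun i _ => BalTensor.smul_tmul R S C (c i) (y i).unop m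
  | add x y hx hy =>
    obtain ⟨m, rfl⟩ := hx
    obtain ⟨m', rfl⟩ := hy
    exact ⟨m + m', by simp [BalTensor.tmul_add, Finset.sum_add_distrib]⟩

end Presentation

theorem HasDegreewiseFiniteProjectiveResolution.exists_presentation {A L : Type u} [Ring A]
    [AddCommGroup L] [Module A L] (h : HasDegreewiseFiniteProjectiveResolution A L) :
    ∃ (a b : ℕ) (c : Fin a → L) (d : (Fin b → A) →ₗ[A] (Fin a → A)),
      Function.Surjective (Fintype.linearCombination A c) ∧
      Function.Exact d (Fintype.linearCombination A c) := by
  obtain ⟨r, d, p, hp, hd, -⟩ := (h.isTypeFP 1).isFinitelyPresented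
  have hpc : p = Fintype.linearCombination A fun i => p (Pi.single i 1) :=
    LinearMap.pi_ext' fun i => LinearMap.ext_ring (by simp)
  exact ⟨r 0, r 1, fun i => p (Pi.single i 1), d 0, hpc ▸ hp, hpc ▸ hd one_pos⟩

variable {n : ℕ} {X : Type u} [AddCommGroup X] [Module S X]

/-- For an `fp_n`-injective module `X`, the natural map `C ⊗_R Hom_S (C, X) → X` is bijective. -/
theorem IsSemidualizing.counit_bijective (hC : IsSemidualizing R S C) (hn : 1 ≤ n)
    (hX : IsFpInjective S X n) : Function.Bijective (counit R S C X) := by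
  obtain ⟨a, b, c, d, hc, hd⟩ := hC.resolution_right.exists_presentation
  have hpres (a : ℕ) : IsFinitelyPresented S (Fin a → C) n :=
    ((hC.resolution_left.isTypeFP n).pi_fin a).isFinitelyPresented
  have hS : IsFinitelyPresented S S n := isFinitelyPresented_of_projective n
  have hinj := generatorMap_injective hC.homothety_left.1 hc
  have hex := generatorMap_matrixMap_exact hC.homothety_left.2 hc hd
  constructor
  · rw [injective_iff_map_eq_zero]
    intro z hz
    obtain ⟨f, rfl⟩ := BalTensor.exists_eq_sum hc z
    -- The hypothesis on `z` says `g c = 0`, so `g` descends to the cokernel of `S → C ^ a`. That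
    -- cokernel embeds in `C ^ b`, and `fp_n`-injectivity extends the induced map to `h`.
    let g : (Fin a → C) →ₗ[S] X := ∑ i, (show C →ₗ[S] X from f i) ∘ₗ LinearMap.proj i
    have hg_apply (x) : g x = ∑ i, f i (x i) := LinearMap.sum_apply _ _ _
    have hg : LinearMap.range (generatorMap S c) ≤ LinearMap.ker g := by
      rw [LinearMap.range_le_ker_iff]
      refine LinearMap.ext_ring ?_
      rw [map_sum] at hz
      rw [LinearMap.comp_apply, generatorMap_one, hg_apply]
      exact hz
    have hβ := hex.linearMap_ker_eq
    obtain ⟨h, hh⟩ := hX _ _ (hS.quotient_range hn (hpres a) hinj) (hpres b)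
      ((LinearMap.range (generatorMap S c)).liftQ _ hβ.ge)
      (LinearMap.ker_eq_bot.1 (Submodule.ker_liftQ_eq_bot _ _ _ hβ.le))
      ((LinearMap.range (generatorMap S c)).liftQ g hg)
    have hh (x : Fin a → C) : h (matrixMap S C (fun j => d (Pi.single j 1)) x) = g x :=
      LinearMap.congr_fun hh (Submodule.Quotient.mk x)
    let k : Fin b → BimodHom R S C X := fun j => h ∘ₗ LinearMap.single S (fun _ => C) j
    have hf (i) : f i = ∑ j, (d (Pi.single j 1) i).unop • k j := by
      refine LinearMap.ext fun x => ?_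
      have hgx : g (Pi.single i x) = f i x := by
        rw [hg_apply, Finset.sum_eq_single i]
        · rw [Pi.single_eq_same]
        · intro j _ hj
          rw [Pi.single_eq_of_ne hj]
          exact map_zero (show C →ₗ[S] X from f j)
        · simp
      refine Eq.trans ?_ (BimodHom.sum_apply _ _ x).symm
      refine hgx.symm.trans ?_
      rw [← hh, ← Finset.univ_sum_single (matrixMap S C _ _), map_sum]
      refine Finset.sum_congr rfl fun j _ => ?_
      rw [matrixMap_apply, Finset.sum_eq_single i]
      · rw [Pi.single_eq_same]
        rfl
      · intro i' _ hi'
        rw [Pi.single_eq_of_ne hi', smul_zero]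
      · simp
    -- Moving the matrix entries across the tensor sign produces, for each `j`, a relation among the
    -- `c i` tensored with `k j`, hence zero.
    simp_rw [hf, BalTensor.tmul_sum, ← BalTensor.smul_tmul]
    rw [Finset.sum_comm]
    refine Finset.sum_eq_zero fun j _ => ?_
    rw [← BalTensor.sum_tmul]
    simp_rw [MulOpposite.op_unop]
    rw [← Fintype.linearCombination_apply, hd.apply_apply_eq_zero, BalTensor.zero_tmul]
  · intro x
    -- Extending `s ↦ s x` along `S → C ^ a` gives `g` with `g c = x`; its components provide a
    -- preimage.
    obtain ⟨g, hg⟩ := hX _ _ hS (hpres a) _ hinj (LinearMap.toSpanSingleton S X x)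
    let f : Fin a → BimodHom R S C X := fun i => g ∘ₗ LinearMap.single S (fun _ => C) i
    refine ⟨∑ i, BalTensor.tmul R S C (c i) (f i), ?_⟩
    have hg : g c = x := by
      have := LinearMap.congr_fun hg (1 : S)
      simpa [generatorMap_one] using this
    rw [map_sum, ← hg]
    conv_rhs => rw [← Finset.univ_sum_single c, map_sum]
    rfl

end Counit

/-! ### Transfer between `C`-`fp_n`-injectives and `fp_n`-injectives. -/

section Auslander

variable {R S C : Type u} [Ring R] [Ring S] [AddCommGroup C] [Module S C] [Module Rᵐᵒᵖ C]
  [SMulCommClass S Rᵐᵒᵖ C] {M M' M'' : Type u} [AddCommGroup M] [Module R M] [AddCommGroup M']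
  [Module R M'] [AddCommGroup M''] [Module R M''] {n k : ℕ}

/-- The conditions defining the Auslander class, except for the vanishing of `Tor`. -/
structure InWeakAuslanderClass (R S C : Type u) [Ring R] [Ring S] [AddCommGroup C] [Module S C]
    [Module Rᵐᵒᵖ C] [SMulCommClass S Rᵐᵒᵖ C] (M : Type u) [AddCommGroup M] [Module R M] :
    Prop where
  ext_eq_zero : ExtVanishes S C (BalTensor R S C M)
  evaluation_bijective : Function.Bijective (evaluation R S C M)

theorem InAuslanderClass.inWeakAuslanderClass (h : InAuslanderClass R S C M) :
    InWeakAuslanderClass R S C M :=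
  ⟨h.ext_eq_zero, h.evaluation_bijective⟩

theorem IsCFpInjective.isFpInjective_balTensor (hC : IsSemidualizing R S C) (hn : 1 ≤ n)
    (h : IsCFpInjective R S C M n) : IsFpInjective S (BalTensor R S C M) n := by
  obtain ⟨X, hX, ⟨e⟩⟩ := h
  exact hX.of_equiv ((BalTensor.congr e).trans
    (LinearEquiv.ofBijective _ (hC.counit_bijective hn hX))).symm

theorem IsCFpInjective.inWeakAuslanderClass (hC : IsSemidualizing R S C) (hn : 1 ≤ n)
    (hS : IsNCoherent S n) (h : IsCFpInjective R S C M n) : InWeakAuslanderClass R S C M where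
  ext_eq_zero i hi := by
    obtain ⟨i, rfl⟩ := Nat.exists_eq_add_of_le' hi
    exact (h.isFpInjective_balTensor hC hn).subsingleton_ext hS
      (hC.resolution_left.isTypeFP n).isFinitelyPresented i
  evaluation_bijective := by
    obtain ⟨X, hX, ⟨e⟩⟩ := h
    exact evaluation_bijective_of_equiv e
      (evaluation_bimodHom_bijective (hC.counit_bijective hn hX))

theorem InWeakAuslanderClass.isCFpInjective (h : InWeakAuslanderClass R S C M)
    (hX : IsFpInjective S (BalTensor R S C M) n) : IsCFpInjective R S C M n :=
  ⟨ModuleCat.of S (BalTensor R S C M), hX, ⟨LinearEquiv.ofBijective _ h.evaluation_bijective⟩⟩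

theorem isCFpInjective_of_subsingleton [Subsingleton M] (n : ℕ) : IsCFpInjective R S C M n := by
  refine ⟨ModuleCat.of S PUnit, isFpInjective_of_subsingleton n, ⟨LinearEquiv.ofBijective 0 ?_⟩⟩
  have : Subsingleton (BimodHom R S C (ModuleCat.of S PUnit.{u + 1})) :=
    inferInstanceAs (Subsingleton (C →ₗ[S] PUnit.{u + 1}))
  exact ⟨fun _ _ _ => Subsingleton.elim _ _, fun _ => ⟨0, Subsingleton.elim _ _⟩⟩

section ShortExact

variable (hC : IsFaithfullySemidualizing R S C) {f : M →ₗ[R] M'} {g : M' →ₗ[R] M''}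

-- Let `K` be the kernel of `C ⊗ f`. A map `C → K` is evaluation at some `m` with `f m = 0`, so
-- `Hom_S(C, K) = 0`, and faithfulness gives `K = 0`.
include hC in
theorem IsFaithfullySemidualizing.map_injective
    (hM : Function.Bijective (evaluation R S C M)) (hM' : Function.Bijective (evaluation R S C M'))
    (hf : Function.Injective f) : Function.Injective (BalTensor.map R S C f) := by
  rw [← LinearMap.ker_eq_bot, ← Submodule.subsingleton_iff_eq_bot]
  refine hC.faithful_left _ (subsingleton_of_forall_eq 0 fun φ => ?_)
  obtain ⟨m, hm⟩ := evaluationAt_surjective hM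
    ((LinearMap.ker (BalTensor.map R S C f)).subtype ∘ₗ φ)
  have hfm : evaluationAt R S C (f m) = evaluationAt R S C (f 0) := by
    rw [← map_comp_evaluationAt, ← map_comp_evaluationAt, hm]
    refine LinearMap.ext fun c => ?_
    have h₁ : BalTensor.map R S C f (φ c) = 0 := (φ c).2
    simp [BalTensor.tmul_zero, h₁]
  obtain rfl : m = 0 := hf (evaluationAt_injective hM' hfm)
  refine LinearMap.ext fun c => Subtype.ext ?_
  have := LinearMap.congr_fun hm c
  simpa [BalTensor.tmul_zero] using this.symm

-- `Hom_S(C, C ⊗ -)` keeps the sequence exact because `Ext^1(C, C ⊗ M) = 0`, so the evaluation for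
-- `M''` is bijective by a five-lemma chase. The Ext condition follows from the long exact sequence.
include hC in
theorem InWeakAuslanderClass.of_exact (hM : InWeakAuslanderClass R S C M)
    (hM' : InWeakAuslanderClass R S C M') (hf : Function.Injective f) (hfg : Function.Exact f g)
    (hg : Function.Surjective g) : InWeakAuslanderClass R S C M'' := by
  have hf' := hC.map_injective hM.2 hM'.2 hf
  have hfg' := BalTensor.map_exact (S := S) (C := C) hfg hg
  have hg' := BalTensor.map_surjective (S := S) (C := C) hg
  refine ⟨fun i hi => subsingleton_ext_of_covariant₃ hf' hfg' hg' (hM'.1 i hi)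
    (hM.1 (i + 1) (by omega)), ?_, fun φ => ?_⟩
  · rw [injective_iff_map_eq_zero]
    intro m hm
    obtain ⟨m', rfl⟩ := hg m
    change evaluationAt R S C (g m') = 0 at hm
    rw [← map_comp_evaluationAt, ← LinearMap.range_le_ker_iff, hfg'.linearMap_ker_eq] at hm
    let e := LinearEquiv.ofInjective _ hf'
    -- The map `c ↦ c ⊗ m'` lands in the image of `C ⊗ M`, so it comes from some `x`; then `m' = f
    -- x` and `g m' = 0`.
    obtain ⟨x, hx⟩ := evaluationAt_surjective hM.2 (e.symm.toLinearMap ∘ₗ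
      (evaluationAt R S C m').codRestrict _ fun c => hm ⟨c, rfl⟩)
    have hfx : f x = m' := by
      refine evaluationAt_injective hM'.2 ?_
      rw [← map_comp_evaluationAt, hx]
      exact LinearMap.ext fun c => congrArg Subtype.val (e.apply_symm_apply _)
    rw [← hfx, hfg.apply_apply_eq_zero]
  · obtain ⟨ψ, hψ⟩ := exists_lift_of_subsingleton_ext hf' hfg' hg' (hM.1 1 le_rfl) φ
    obtain ⟨m, rfl⟩ := evaluationAt_surjective hM'.2 ψ
    exact ⟨g m, (map_comp_evaluationAt g m).symm.trans hψ⟩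

include hC in
theorem IsCFpInjective.hasFpInjectiveDimensionLE_succ_iff (hn : 1 ≤ n) (hS : IsNCoherent S n)
    (hM : InWeakAuslanderClass R S C M) (hM' : IsCFpInjective R S C M' n)
    (hf : Function.Injective f) (hfg : Function.Exact f g) (hg : Function.Surjective g) (k : ℕ) :
    HasFpInjectiveDimensionLE S n (k + 1) (BalTensor R S C M) ↔
      HasFpInjectiveDimensionLE S n k (BalTensor R S C M'') :=
  Semidual.hasFpInjectiveDimensionLE_succ_iff hS
    (hC.map_injective hM.2 (hM'.inWeakAuslanderClass hC.1 hn hS).2 hf) (BalTensor.map_exact hfg hg)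
    (BalTensor.map_surjective hg) (hM'.isFpInjective_balTensor hC.1 hn) k

end ShortExact

/-! ### Splicing coresolutions and induction on their length. -/

section Coresolution

/-- The coresolution of `coker ε` obtained by removing the first term. -/
def FiniteCoresolution.tail (E : FiniteCoresolution R M (k + 1)) :
    FiniteCoresolution R (E.X 0 ⧸ LinearMap.range E.ε) k where
  X i := E.X (i + 1)
  ε := (LinearMap.range E.ε).liftQ (E.d 0) E.exact_zero.linearMap_ker_eq.ge
  d i := E.d (i + 1)
  injective_ε := LinearMap.ker_eq_bot.1
    (Submodule.ker_liftQ_eq_bot _ _ _ E.exact_zero.linearMap_ker_eq.le)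
  exact_zero := by
    rw [LinearMap.exact_iff, Submodule.range_liftQ]
    exact (E.exact_succ 0).linearMap_ker_eq
  exact_succ i := E.exact_succ (i + 1)
  subsingleton_of_lt i hi := E.subsingleton_of_lt (i + 1) (by omega)

/-- The coresolution of `M` obtained by splicing `0 → M → I → M'' → 0` with a coresolution
of `M''`. -/
def FiniteCoresolution.cons (I : ModuleCat.{u} R) {f : M →ₗ[R] I} {g : I →ₗ[R] M''}
    (hf : Function.Injective f) (hfg : Function.Exact f g) (hg : Function.Surjective g)
    (E : FiniteCoresolution R M'' k) : FiniteCoresolution R M (k + 1) where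
  X i := Nat.casesOn i I E.X
  ε := f
  d i := match i with
    | 0 => E.ε ∘ₗ g
    | i + 1 => E.d i
  injective_ε := hf
  exact_zero := hfg.comp_injective _ E.injective_ε (map_zero E.ε)
  exact_succ i := match i with
    | 0 => (hg.comp_exact_iff_exact (f := E.ε)).2 E.exact_zero
    | i + 1 => E.exact_succ i
  subsingleton_of_lt i hi := match i with
    | i + 1 => E.subsingleton_of_lt i (by omega)

/-- A coresolution of length `0` is an isomorphism. -/
noncomputable def FiniteCoresolution.equiv (E : FiniteCoresolution R M 0) : M ≃ₗ[R] E.X 0 :=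
  LinearEquiv.ofBijective E.ε ⟨E.injective_ε, fun x => (E.exact_zero x).1 <|
    have := E.subsingleton_of_lt 1 one_pos
    Subsingleton.elim _ _⟩

/-- The identity as a coresolution of length `0`. -/
def FiniteCoresolution.self (R M : Type u) [Ring R] [AddCommGroup M] [Module R M] :
    FiniteCoresolution R M 0 where
  X i := Nat.casesOn i (ModuleCat.of R M) fun _ => ModuleCat.of R PUnit
  ε := LinearMap.id
  d _ := 0
  injective_ε := Function.injective_id
  exact_zero := fun x => ⟨fun _ => ⟨x, rfl⟩, fun _ => rfl⟩
  exact_succ _ := fun _ => ⟨fun _ => ⟨0, Subsingleton.elim (α := PUnit) _ _⟩, fun _ => rfl⟩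
  subsingleton_of_lt i _ := match i with
    | _ + 1 => inferInstanceAs (Subsingleton PUnit)

/-- A coresolution of length `j` is also one of length `k` for `j ≤ k`. -/
def FiniteCoresolution.ofLE {j : ℕ} (E : FiniteCoresolution R M j) (hjk : j ≤ k) :
    FiniteCoresolution R M k :=
  { E with subsingleton_of_lt := fun i hi => E.subsingleton_of_lt i (hjk.trans_lt hi) }

theorem IsCFpInjective.of_equiv (h : IsCFpInjective R S C M n) (e : M ≃ₗ[R] M') :
    IsCFpInjective R S C M' n := by
  obtain ⟨X, hX, ⟨e'⟩⟩ := h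
  exact ⟨X, hX, ⟨e.symm.trans e'⟩⟩

/-- Each cosyzygy stays in the weak Auslander class and shifts the Ext degree by one, until an
isomorphism with the last term remains. -/
theorem FiniteCoresolution.hasFpInjectiveDimensionLE (hC : IsFaithfullySemidualizing R S C)
    (hn : 1 ≤ n) (hS : IsNCoherent S n) (hM : InWeakAuslanderClass R S C M)
    (E : FiniteCoresolution R M k) (hE : ∀ i ≤ k, IsCFpInjective R S C (E.X i) n) :
    HasFpInjectiveDimensionLE S n k (BalTensor R S C M) := by
  induction k generalizing M with
  | zero =>
    intro L _ _ hL
    exact (((hE 0 le_rfl).of_equiv E.equiv.symm).isFpInjective_balTensor hC.1 hn).subsingleton_ext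
      hS hL 0
  | succ k ih =>
    have hE₀ := hE 0 (by omega)
    rw [hE₀.hasFpInjectiveDimensionLE_succ_iff hC hn hS hM E.injective_ε
      (LinearMap.exact_map_mkQ_range E.ε) (Submodule.mkQ_surjective _)]
    exact ih (hM.of_exact hC (hE₀.inWeakAuslanderClass hC.1 hn hS) E.injective_ε
      (LinearMap.exact_map_mkQ_range E.ε) (Submodule.mkQ_surjective _)) E.tail
      fun i hi => hE (i + 1) (by omega)

/-- The same shift, now lowering a known bound: at the end `Ext^1` vanishes on `C ⊗` the last
cosyzygy, and bijective evaluation recovers that cosyzygy. -/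
theorem FiniteCoresolution.isCFpInjective_last (hC : IsFaithfullySemidualizing R S C)
    (hn : 1 ≤ n) (hS : IsNCoherent S n) (hM : InWeakAuslanderClass R S C M)
    (hk : HasFpInjectiveDimensionLE S n k (BalTensor R S C M))
    (E : FiniteCoresolution R M k) (hE : ∀ i < k, IsCFpInjective R S C (E.X i) n) :
    IsCFpInjective R S C (E.X k) n := by
  induction k generalizing M with
  | zero =>
    exact (hM.isCFpInjective (isFpInjective_of_hasFpInjectiveDimensionLE_zero hn hk)).of_equiv
      E.equiv
  | succ k ih =>
    have hE₀ := hE 0 (by omega)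
    rw [hE₀.hasFpInjectiveDimensionLE_succ_iff hC hn hS hM E.injective_ε
      (LinearMap.exact_map_mkQ_range E.ε) (Submodule.mkQ_surjective _)] at hk
    exact ih (hM.of_exact hC (hE₀.inWeakAuslanderClass hC.1 hn hS) E.injective_ε
      (LinearMap.exact_map_mkQ_range E.ε) (Submodule.mkQ_surjective _)) hk E.tail
      fun i hi => hE (i + 1) (by omega)

/-- Compose the evaluation `M → Hom_S(C, C ⊗ M)` with the map induced by an embedding of `C ⊗ M` in
an injective `S`-module. -/
theorem InWeakAuslanderClass.exists_injective (hM : InWeakAuslanderClass R S C M) (n : ℕ) :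
    ∃ (I : ModuleCat.{u} R) (f : M →ₗ[R] I), IsCFpInjective R S C I n ∧ Function.Injective f := by
  let B := ModuleCat.of S (BalTensor R S C M)
  let J := Injective.under B
  have hJ : Injective (ModuleCat.of S J) := Injective.injective_under B
  have : Module.Injective S J := Module.injective_module_of_injective_object S J
  have hι : Function.Injective (Injective.ι B).hom :=
    (ModuleCat.mono_iff_injective _).1 (Injective.ι_mono B)
  refine ⟨ModuleCat.of R (BimodHom R S C J),
    BimodHom.map R (Injective.ι B).hom ∘ₗ evaluation R S C M,
    ⟨J, isFpInjective_of_injective n, ⟨LinearEquiv.refl _ _⟩⟩, ?_⟩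
  have hmap : Function.Injective (BimodHom.map R (C := C) (Injective.ι B).hom) :=
    fun φ ψ h => LinearMap.ext fun c => hι (LinearMap.congr_fun h c)
  exact hmap.comp hM.2.1

theorem InWeakAuslanderClass.exists_finiteCoresolution (hC : IsFaithfullySemidualizing R S C)
    (hn : 1 ≤ n) (hS : IsNCoherent S n) (hM : InWeakAuslanderClass R S C M) (k : ℕ) :
    ∃ E : FiniteCoresolution R M k, ∀ i < k, IsCFpInjective R S C (E.X i) n := by
  induction k generalizing M with
  | zero => exact ⟨FiniteCoresolution.self R M, by simp⟩
  | succ k ih =>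
    obtain ⟨I, f, hI, hf⟩ := hM.exists_injective n
    obtain ⟨E, hE⟩ := ih (hM.of_exact hC (hI.inWeakAuslanderClass hC.1 hn hS) hf
      (LinearMap.exact_map_mkQ_range f) (Submodule.mkQ_surjective _))
    refine ⟨E.cons I hf (LinearMap.exact_map_mkQ_range f) (Submodule.mkQ_surjective _),
      fun i hi => ?_⟩
    cases i with
    | zero => exact hI
    | succ i => exact hE i (by omega)

theorem cfpInjectiveDimension_le_iff :
    cfpInjectiveDimension R S C M n ≤ (k : ℕ∞) ↔
      ∃ E : FiniteCoresolution R M k, ∀ i ≤ k, IsCFpInjective R S C (E.X i) n := by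
  refine ⟨fun h => ?_, fun h => iInf₂_le k h⟩
  -- A strict bound on the infimum yields an actual coresolution, of some length `j ≤ k`.
  have h : cfpInjectiveDimension R S C M n < ((k + 1 : ℕ) : ℕ∞) :=
    h.trans_lt (Nat.cast_lt.2 k.lt_succ_self)
  obtain ⟨j, ⟨E, hE⟩, hj⟩ := by simpa only [cfpInjectiveDimension, iInf_lt_iff] using h
  have hjk : j ≤ k := Nat.lt_succ_iff.1 (Nat.cast_lt.1 hj)
  refine ⟨E.ofLE hjk, fun i hi => ?_⟩
  rcases le_or_gt i j with hij | hij
  · exact hE i hij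
  -- Beyond `j` the padding terms are zero, and the zero module is `C`-`fp_n`-injective.
  · have := E.subsingleton_of_lt i hij
    exact isCFpInjective_of_subsingleton (M := E.X i) n

end Coresolution

end Auslander

end Semidual

theorem theorem4p8 (R S C : Type u) [Ring R] [Ring S]
    [AddCommGroup C] [Module S C] [Module Rᵐᵒᵖ C] [SMulCommClass S Rᵐᵒᵖ C]
    (n : ℕ) (hn : 1 ≤ n) (k : ℕ)
    (hS : Semidual.IsNCoherent S n)
    (hC : Semidual.IsFaithfullySemidualizing R S C)
    (M : Type u) [AddCommGroup M] [Module R M]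
    (hM : Semidual.InAuslanderClass R S C M) :
    List.TFAE [
      Semidual.cfpInjectiveDimension R S C M n ≤ (k : ℕ∞),
      ∀ E : Semidual.FiniteCoresolution R M k,
        (∀ i < k, Semidual.IsCFpInjective R S C (E.X i) n) →
          Semidual.IsCFpInjective R S C (E.X k) n,
      ∃ E : Semidual.FiniteCoresolution R M k,
        ∀ i ≤ k, Semidual.IsCFpInjective R S C (E.X i) n] := by
  have hM' := hM.inWeakAuslanderClass
  tfae_have 1 ↔ 3 := Semidual.cfpInjectiveDimension_le_iff
  -- `E'` bounds the Ext dimension of `C ⊗ M`, and this bound applies to the unrelated coresolution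
  -- `E`.
  tfae_have 3 → 2 := fun ⟨E', hE'⟩ E hE =>
    E.isCFpInjective_last hC hn hS hM' (E'.hasFpInjectiveDimensionLE hC hn hS hM' hE') hE
  tfae_have 2 → 3 := fun h => by
    obtain ⟨E, hE⟩ := hM'.exists_finiteCoresolution hC hn hS k
    refine ⟨E, fun i hi => ?_⟩
    rcases hi.lt_or_eq with hi | rfl
    · exact hE i hi
    · exact h E hE
  tfae_finish
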